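/- Let $p,q\ge 0$ be integers and $n=p+q$. A $(p,q)$-clan is an involution of $\{1,\dots,n\}$ (an element $\sigma\in S_n$ with $\sigma^2=1$) each of whose fixed points is decorated by a sign $+$ or $-$, such that the number of $+$ signs minus the number of $-$ signs is $p-q$. It is written as a string $c_1\cdots c_n$, where $c_i$ is the sign of $i$ if $i$ is fixed, and where $c_i=c_j\in\mathbb N$ is a pair of matching natural numbers if the involution interchanges $i\neq j$ (a different number for each such pair; the choice of the numbers is immaterial). For a clan $\gamma=c_1\cdots c_n$ let - $\gamma(i;+)$, respectively $\gamma(i;-)$, be the number of $+$ signs, respectively $-$ signs, among $c_1,\dots,c_i$ plus the number of pairs of equal natural numbers occurring among $c_1,\dots,c_i$ ($1\le i\le n$); - $\gamma(i;j)$ be the number of pairs of equal natural numbers $c_s=c_t$ with $s\le i<j<t$ ($1\le i<j\le n$). The combinatorial Bruhat order on $(p,q)$-clans is defined by: $\gamma\le\tau$ if and only if $\gamma(i;+)\ge\tau(i;+)$ and $\gamma(i;-)\ge\tau(i;-)$ for all $i$, and $\gamma(i;j)\le\tau(i;j)$ for all $i<j$. Write $\gamma<\tau$ if $\gamma\le\tau$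 and $\gamma\ne\tau$. **Theorem.** Let $\gamma,\tau$ be $(p,q)$-clans with $\gamma<\tau$. Then there is a $(p,q)$-clan $\gamma'$ with $\gamma<\gamma'\le\tau$ which is obtained from $\gamma$ by one of the following ten moves, in each of which the symbols of $\gamma$ at some positions $i_1<i_2<\cdots$ (not necessarily consecutive) form the pattern on the left and are replaced by the pattern on the right, all other symbols being unchanged (in a pattern, equal numbers stand for a pair of matching natural numbers, and different numbers for different pairs): 1. $+-\ \to\ 11$; 2. $-+\ \to\ 11$; 3. $11+\ \to\ 1{+}1$; 4. $11-\ \to\ 1{-}1$; 5. $+11\ \to\ 1{+}1$; 6. $-11\ \to\ 1{-}1$; 7. $1122\ \to\ 1212$; 8. $1122\ \to\ 1{+}{-}1$; 9. $1122\ \to\ 1{-}{+}1$; 10. $1212\ \to\ 1221$. -/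

import Mathlib

/-- A clan of signature `(p, q)`: an involution `mate` of the `p + q` positions, each fixed point of
which carries a sign `+` or `-` (`sign i = 1` or `sign i = -1`; the value `0` marks exactly the
positions that are not fixed, i.e. those carrying a natural number), such that the number of `+`
signs minus the number of `-` signs is `p - q`.  The two positions `i` and `mate i ≠ i` carry
matching natural numbers. -/
@[ext]
structure Clan (p q : ℕ) where
  mate : Equiv.Perm (Fin (p + q))
  mate_mate : ∀ i, mate (mate i) = i
  sign : Fin (p + q) → SignType
  sign_ne_zero_iff : ∀ i, sign i ≠ 0 ↔ mate i = i
  signature : ((Finset.univ.filter fun i => sign i = 1).card : ℤ)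
    - ((Finset.univ.filter fun i => sign i = -1).card : ℤ) = (p : ℤ) - (q : ℤ)

namespace Clan

variable {p q : ℕ}

/-- The number of pairs of equal natural numbers occurring among `c_1 ... c_i`; a pair is counted
through its first occurrence `s`. -/
def pairsUpTo (γ : Clan p q) (i : Fin (p + q)) : ℕ :=
  (Finset.univ.filter fun s => s < γ.mate s ∧ γ.mate s ≤ i).card

/-- `γ(i; +)`: the number of plus signs and pairs of equal natural numbers among `c_1 ... c_i`. -/
def rankPlus (γ : Clan p q) (i : Fin (p + q)) : ℕ :=
  (Finset.univ.filter fun s => s ≤ i ∧ γ.sign s = 1).card + γ.pairsUpTo i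

/-- `γ(i; -)`: the number of minus signs and pairs of equal natural numbers among `c_1 ... c_i`. -/
def rankMinus (γ : Clan p q) (i : Fin (p + q)) : ℕ :=
  (Finset.univ.filter fun s => s ≤ i ∧ γ.sign s = -1).card + γ.pairsUpTo i

/-- `γ(i; j)`, used for `i < j`: the number of pairs of equal natural numbers `c_s = c_t` with
`s ≤ i < j < t`. -/
def rankPair (γ : Clan p q) (i j : Fin (p + q)) : ℕ :=
  (Finset.univ.filter fun s => s ≤ i ∧ j < γ.mate s).card

/-- The combinatorial Bruhat order on `(p, q)`-clans. -/
instance : LE (Clan p q) where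
  le γ τ := (∀ i, τ.rankPlus i ≤ γ.rankPlus i) ∧ (∀ i, τ.rankMinus i ≤ γ.rankMinus i) ∧
    ∀ i j, i < j → γ.rankPair i j ≤ τ.rankPair i j

/-- The strict relation: `γ ≤ τ` and `γ ≠ τ`. -/
instance : LT (Clan p q) where
  lt γ τ := γ ≤ τ ∧ γ ≠ τ

/-- `γ` and `γ'` carry the same symbols (with the same mates) at all positions outside `S`. -/
def AgreeOff (S : Set (Fin (p + q))) (γ γ' : Clan p q) : Prop :=
  ∀ x, x ∉ S → γ'.mate x = γ.mate x ∧ γ'.sign x = γ.sign x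

/-- `Move γ γ'`: the clan `γ'` is obtained from `γ` by replacing a pattern, found at positions
`i < j (< k (< l))`, by another one at the same positions, where everything else is unchanged.
The equation `mate a = b` with `a < b` says that positions `a` and `b` carry a pair of matching
natural numbers. -/
inductive Move (γ γ' : Clan p q) : Prop
  /-- `+-` becomes `11` -/
  | plus_minus (i j : Fin (p + q)) (hij : i < j)
      (before : γ.sign i = 1 ∧ γ.sign j = -1)
      (after : γ'.mate i = j)
      (off : AgreeOff {i, j} γ γ')
  /-- `-+` becomes `11` -/
  | minus_plus (i j : Fin (p + q)) (hij : i < j)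
      (before : γ.sign i = -1 ∧ γ.sign j = 1)
      (after : γ'.mate i = j)
      (off : AgreeOff {i, j} γ γ')
  /-- `11+` becomes `1+1` -/
  | pair_plus (i j k : Fin (p + q)) (hij : i < j) (hjk : j < k)
      (before : γ.mate i = j ∧ γ.sign k = 1)
      (after : γ'.mate i = k ∧ γ'.sign j = 1)
      (off : AgreeOff {i, j, k} γ γ')
  /-- `11-` becomes `1-1` -/
  | pair_minus (i j k : Fin (p + q)) (hij : i < j) (hjk : j < k)
      (before : γ.mate i = j ∧ γ.sign k = -1)
      (after : γ'.mate i = k ∧ γ'.sign j = -1)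
      (off : AgreeOff {i, j, k} γ γ')
  /-- `+11` becomes `1+1` -/
  | plus_pair (i j k : Fin (p + q)) (hij : i < j) (hjk : j < k)
      (before : γ.sign i = 1 ∧ γ.mate j = k)
      (after : γ'.mate i = k ∧ γ'.sign j = 1)
      (off : AgreeOff {i, j, k} γ γ')
  /-- `-11` becomes `1-1` -/
  | minus_pair (i j k : Fin (p + q)) (hij : i < j) (hjk : j < k)
      (before : γ.sign i = -1 ∧ γ.mate j = k)
      (after : γ'.mate i = k ∧ γ'.sign j = -1)
      (off : AgreeOff {i, j, k} γ γ')
  /-- `1122` becomes `1212` -/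
  | cross (i j k l : Fin (p + q)) (hij : i < j) (hjk : j < k) (hkl : k < l)
      (before : γ.mate i = j ∧ γ.mate k = l)
      (after : γ'.mate i = k ∧ γ'.mate j = l)
      (off : AgreeOff {i, j, k, l} γ γ')
  /-- `1122` becomes `1+-1` -/
  | join_plus_minus (i j k l : Fin (p + q)) (hij : i < j) (hjk : j < k) (hkl : k < l)
      (before : γ.mate i = j ∧ γ.mate k = l)
      (after : γ'.mate i = l ∧ γ'.sign j = 1 ∧ γ'.sign k = -1)
      (off : AgreeOff {i, j, k, l} γ γ')
  /-- `1122` becomes `1-+1` -/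
  | join_minus_plus (i j k l : Fin (p + q)) (hij : i < j) (hjk : j < k) (hkl : k < l)
      (before : γ.mate i = j ∧ γ.mate k = l)
      (after : γ'.mate i = l ∧ γ'.sign j = -1 ∧ γ'.sign k = 1)
      (off : AgreeOff {i, j, k, l} γ γ')
  /-- `1212` becomes `1221` -/
  | nest (i j k l : Fin (p + q)) (hij : i < j) (hjk : j < k) (hkl : k < l)
      (before : γ.mate i = k ∧ γ.mate j = l)
      (after : γ'.mate i = l ∧ γ'.mate j = k)
      (off : AgreeOff {i, j, k, l} γ γ')

end Clan

namespace Clan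

variable {p q : ℕ}

/-! Let `f` be the first position where the clans differ. The rank inequalities force `τ` to have a
first occurrence at `f`, with mate `m` say, and `γ` to have there either a sign or a first
occurrence with mate `a < m`. The move is chosen by looking at `γ` on the positions up to `m`.

Two facts carry the argument. Each move changes the ranks by 1 (for `1122 → 1212`, in one region by
2) on explicit ranges of positions, so `γ' ≤ τ` only has to be checked there. And the two sign ranks
and the number of open pairs at a position add up to the same number for every clan, so that slack
in one forces slack in another.

If `γ` has a sign `ε` at `f`, the first later `-ε`, or first pair inside the interval up to `m`,
serves as partner (`exists_move_of_sign`). If `γ` has a pair `f, a`, then in turn: a pair crossing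
it and ending by `m` is nested; a sign or a pair lying in `(a, m]` is absorbed; failing both, the
pair is crossed with the one opening in `(a, m]` that closes earliest (`exists_move_of_pair`). The
required slack holds because `γ`, lacking closer candidates, has no second occurrences to match the
one `τ` has at `m`. -/

/-! ### Sign ranks and the diagonal identity -/

theorem mate_eq_comm (γ : Clan p q) {i j : Fin (p + q)} : γ.mate i = j ↔ γ.mate j = i :=
  ⟨fun h => h ▸ γ.mate_mate i, fun h => h ▸ γ.mate_mate j⟩

theorem sign_eq_zero_iff (γ : Clan p q) (i : Fin (p + q)) : γ.sign i = 0 ↔ γ.mate i ≠ i := by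
  rw [Ne, ← γ.sign_ne_zero_iff, not_not]

theorem mate_eq_self (γ : Clan p q) {i : Fin (p + q)} {ε : SignType} (hε : ε ≠ 0)
    (h : γ.sign i = ε) : γ.mate i = i :=
  (γ.sign_ne_zero_iff i).1 (h ▸ hε)

/-- The number of symbols `ε` and of second occurrences of natural numbers among `c_1 ... c_i`. -/
def signRank (γ : Clan p q) (ε : SignType) (i : Fin (p + q)) : ℕ :=
  (Finset.univ.filter fun s => s ≤ i ∧ (γ.sign s = ε ∨ γ.mate s < s)).card

theorem pairsUpTo_eq (γ : Clan p q) (i : Fin (p + q)) :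
    γ.pairsUpTo i = (Finset.univ.filter fun s => s ≤ i ∧ γ.mate s < s).card := by
  unfold pairsUpTo
  refine Finset.card_bij (fun s _ => γ.mate s) ?_ ?_ ?_
  · intro s hs
    simp only [Finset.mem_filter, Finset.mem_univ, true_and, γ.mate_mate] at hs ⊢
    exact ⟨hs.2, hs.1⟩
  · intro s _ t _ h
    exact γ.mate.injective h
  · intro s hs
    simp only [Finset.mem_filter, Finset.mem_univ, true_and] at hs
    exact ⟨γ.mate s, by simpa [γ.mate_mate] using hs.symm, γ.mate_mate s⟩

theorem card_sign_add_pairsUpTo (γ : Clan p q) {ε : SignType} (hε : ε ≠ 0) (i : Fin (p + q)) :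
    (Finset.univ.filter fun s => s ≤ i ∧ γ.sign s = ε).card + γ.pairsUpTo i = γ.signRank ε i := by
  rw [pairsUpTo_eq, signRank, ← Finset.card_union_of_disjoint]
  · congr 1
    ext s
    simp only [Finset.mem_union, Finset.mem_filter, Finset.mem_univ, true_and]
    tauto
  · rw [Finset.disjoint_filter]
    rintro s - ⟨-, h⟩ ⟨-, h'⟩
    exact h'.ne (γ.mate_eq_self hε h)

theorem rankPlus_eq (γ : Clan p q) (i : Fin (p + q)) : γ.rankPlus i = γ.signRank 1 i :=
  γ.card_sign_add_pairsUpTo (by decide) i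

theorem rankMinus_eq (γ : Clan p q) (i : Fin (p + q)) : γ.rankMinus i = γ.signRank (-1) i :=
  γ.card_sign_add_pairsUpTo (by decide) i

theorem eq_or_eq_neg {ε δ : SignType} (hε : ε ≠ 0) (hδ : δ ≠ 0) : δ = ε ∨ δ = -ε := by
  revert hε hδ; revert ε δ; decide

theorem ne_neg_self_of_ne_zero {ε : SignType} (hε : ε ≠ 0) : ε ≠ -ε := by
  revert hε; revert ε; decide

theorem neg_ne_zero_of_ne_zero {ε : SignType} (hε : ε ≠ 0) : -ε ≠ 0 := by
  revert hε; revert ε; decide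

theorem le_iff (γ τ : Clan p q) : γ ≤ τ ↔
    (∀ δ : SignType, δ ≠ 0 → ∀ i, τ.signRank δ i ≤ γ.signRank δ i) ∧
      ∀ i j, i < j → γ.rankPair i j ≤ τ.rankPair i j := by
  change ((∀ i, τ.rankPlus i ≤ γ.rankPlus i) ∧ (∀ i, τ.rankMinus i ≤ γ.rankMinus i) ∧
    ∀ i j, i < j → γ.rankPair i j ≤ τ.rankPair i j) ↔ _
  simp only [rankPlus_eq, rankMinus_eq]
  constructor
  · rintro ⟨h₁, h₂, h₃⟩
    refine ⟨fun δ hδ => ?_, h₃⟩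
    rcases eq_or_eq_neg (ε := 1) (by decide) hδ with rfl | rfl
    exacts [h₁, h₂]
  · rintro ⟨h, h₃⟩
    exact ⟨h 1 (by decide), h (-1) (by decide), h₃⟩

/-- A sign counts in one sign rank, a pair completed by `i` twice for its two positions, and a pair
still open at `i` once in `rankPair i i`. -/
theorem signRank_add_signRank_neg (γ : Clan p q) {ε : SignType} (hε : ε ≠ 0) (i : Fin (p + q)) :
    γ.signRank ε i + γ.signRank (-ε) i + γ.rankPair i i =
      (Finset.univ.filter fun s : Fin (p + q) => s ≤ i).card := by
  have hε' := neg_ne_zero_of_ne_zero hε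
  rw [← γ.card_sign_add_pairsUpTo hε, ← γ.card_sign_add_pairsUpTo hε', rankPair]
  nth_rewrite 1 [pairsUpTo_eq]
  unfold pairsUpTo
  simp only [Finset.card_filter, ← Finset.sum_add_distrib]
  refine Finset.sum_congr rfl fun s _ => ?_
  have hs := γ.sign_ne_zero_iff s
  rcases lt_trichotomy (γ.mate s) s with h | h | h
  · have h0 : γ.sign s = 0 := (γ.sign_eq_zero_iff s).2 h.ne
    simp only [h0, hε.symm, hε'.symm, h, h.not_gt]
    by_cases h1 : s ≤ i
    · simp [h1, (h.le.trans h1).not_gt]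
    · simp [h1]
  · rcases eq_or_eq_neg hε (hs.2 h) with h1 | h1
    · have := ne_neg_self_of_ne_zero hε
      by_cases h2 : s ≤ i <;> simp [h1, h, h2, this]
    · have := (ne_neg_self_of_ne_zero hε).symm
      by_cases h2 : s ≤ i <;> simp [h1, h, h2, this]
  · have h0 : γ.sign s = 0 := (γ.sign_eq_zero_iff s).2 h.ne'
    simp only [h0, hε.symm, hε'.symm, h, h.not_gt]
    by_cases h1 : γ.mate s ≤ i
    · simp [h1, h.le.trans h1, h1.not_gt]
    · by_cases h2 : s ≤ i <;> simp [h1, h2, not_le.1 h1]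

/-! ### Local modifications of a clan -/

theorem card_filter_of_agree {α : Type*} [Fintype α] [DecidableEq α] {A B : α → Prop}
    [DecidablePred A] [DecidablePred B] (S : Finset α) (h : ∀ s, s ∉ S → (B s ↔ A s)) :
    ((Finset.univ.filter B).card : ℤ) = (Finset.univ.filter A).card +
      ∑ s ∈ S, ((if B s then 1 else 0) - (if A s then 1 else 0) : ℤ) := by
  have hsum : ∑ s ∈ S, ((if B s then 1 else 0) - (if A s then 1 else 0) : ℤ) =
      ∑ s, ((if B s then 1 else 0) - (if A s then 1 else 0) : ℤ) :=
    Finset.sum_subset S.subset_univ fun s _ hs => by simp [h s hs]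
  rw [hsum, Finset.sum_sub_distrib, Finset.sum_boole, Finset.sum_boole]
  simp

theorem sum_sign {n : ℕ} (σ : Fin n → SignType) : ∑ s, (σ s : ℤ) =
    ((Finset.univ.filter fun i => σ i = 1).card : ℤ)
      - ((Finset.univ.filter fun i => σ i = -1).card : ℤ) := by
  rw [Finset.card_filter, Finset.card_filter]
  push_cast
  rw [← Finset.sum_sub_distrib]
  refine Finset.sum_congr rfl fun s _ => ?_
  generalize σ s = ε
  revert ε
  decide

theorem exists_modification (γ : Clan p q) (S : Finset (Fin (p + q)))
    (m : Fin (p + q) → Fin (p + q)) (σ : Fin (p + q) → SignType)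
    (hS : ∀ s ∈ S, γ.mate s ∈ S) (hm : ∀ s ∈ S, m s ∈ S ∧ m (m s) = s)
    (hσ : ∀ s ∈ S, (σ s ≠ 0 ↔ m s = s))
    (hsum : ∑ s ∈ S, (σ s : ℤ) = ∑ s ∈ S, (γ.sign s : ℤ)) :
    ∃ γ' : Clan p q, (∀ s ∈ S, γ'.mate s = m s ∧ γ'.sign s = σ s) ∧ AgreeOff ↑S γ γ' := by
  have hS' : ∀ s, s ∉ S → γ.mate s ∉ S := fun s hs h => hs (by simpa [γ.mate_mate] using hS _ h)
  have hinv : Function.Involutive fun s => if s ∈ S then m s else γ.mate s := by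
    intro s
    by_cases h : s ∈ S
    · simp [h, (hm s h).1, (hm s h).2]
    · simp [h, hS' s h, γ.mate_mate]
  refine ⟨⟨hinv.toPerm, hinv, fun s => if s ∈ S then σ s else γ.sign s, ?_, ?_⟩, ?_, ?_⟩
  · intro s
    by_cases h : s ∈ S
    · simpa [h] using hσ s h
    · simpa [h] using γ.sign_ne_zero_iff s
  · rw [← γ.signature, ← sum_sign, ← sum_sign, ← Finset.sum_add_sum_compl S,
      ← Finset.sum_add_sum_compl S fun s => (γ.sign s : ℤ), ← hsum]
    congr 1
    · exact Finset.sum_congr rfl fun s hs => by simp [hs]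
    · exact Finset.sum_congr rfl fun s hs => by simp [Finset.mem_compl.1 hs]
  · intro s hs
    simp [hs]
  · intro s hs
    simp [Finset.mem_coe.not.1 hs]

theorem signRank_of_agreeOff {γ γ' : Clan p q} {S : Finset (Fin (p + q))}
    (h : AgreeOff ↑S γ γ') (δ : SignType) (x : Fin (p + q)) :
    (γ'.signRank δ x : ℤ) = γ.signRank δ x +
      ∑ s ∈ S, ((if s ≤ x ∧ (γ'.sign s = δ ∨ γ'.mate s < s) then 1 else 0) -
        (if s ≤ x ∧ (γ.sign s = δ ∨ γ.mate s < s) then 1 else 0)) :=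
  card_filter_of_agree S fun s hs => by
    rw [(h s (Finset.mem_coe.not.2 hs)).1, (h s (Finset.mem_coe.not.2 hs)).2]

theorem rankPair_of_agreeOff {γ γ' : Clan p q} {S : Finset (Fin (p + q))}
    (h : AgreeOff ↑S γ γ') (x y : Fin (p + q)) :
    (γ'.rankPair x y : ℤ) = γ.rankPair x y +
      ∑ s ∈ S, ((if s ≤ x ∧ y < γ'.mate s then 1 else 0) -
        (if s ≤ x ∧ y < γ.mate s then 1 else 0)) :=
  card_filter_of_agree S fun s hs => by rw [(h s (Finset.mem_coe.not.2 hs)).1]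

/-- `A` is the drop of the sign ranks and `B` the rise of the pair ranks; elsewhere the bounds by
`τ` are inherited from `γ`. -/
theorem lt_of_ranks {γ γ' τ : Clan p q} (h : γ ≤ τ) (hne : γ ≠ γ')
    (A : SignType → Fin (p + q) → ℕ) (B : Fin (p + q) → Fin (p + q) → ℕ)
    (hA : ∀ δ x, δ ≠ 0 → γ.signRank δ x = γ'.signRank δ x + A δ x)
    (hB : ∀ x y, x < y → γ'.rankPair x y = γ.rankPair x y + B x y)
    (hAτ : ∀ δ x, A δ x ≠ 0 → τ.signRank δ x + A δ x ≤ γ.signRank δ x)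
    (hBτ : ∀ x y, x < y → B x y ≠ 0 → γ.rankPair x y + B x y ≤ τ.rankPair x y) :
    γ < γ' ∧ γ' ≤ τ := by
  rw [le_iff] at h
  refine ⟨⟨(le_iff _ _).2 ⟨fun δ hδ x => ?_, fun x y hxy => ?_⟩, hne⟩,
    (le_iff _ _).2 ⟨fun δ hδ x => ?_, fun x y hxy => ?_⟩⟩
  · rw [hA δ x hδ]; omega
  · rw [hB x y hxy]; omega
  · have h₁ := hA δ x hδ
    have h₂ := hAτ δ x
    have h₃ := h.1 δ hδ x
    omega
  · have h₁ := hB x y hxy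
    have h₂ := hBτ x y hxy
    have h₃ := h.2 x y hxy
    omega

/-! ### Rank conditions under which each move stays below `τ` -/

theorem exists_move_sign_neg {γ τ : Clan p q} (h : γ ≤ τ) {ε : SignType} (hε : ε ≠ 0)
    {i j : Fin (p + q)} (hij : i < j) (hi : γ.sign i = ε) (hj : γ.sign j = -ε)
    (hs : ∀ x, i ≤ x → x < j → τ.signRank ε x + 1 ≤ γ.signRank ε x)
    (hp : ∀ x y, x < y → i ≤ x → y < j → γ.rankPair x y + 1 ≤ τ.rankPair x y) :
    ∃ γ', γ < γ' ∧ γ' ≤ τ ∧ Move γ γ' := by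
  have hgi := γ.mate_eq_self hε hi
  have hgj := γ.mate_eq_self (neg_ne_zero_of_ne_zero hε) hj
  have hne := ne_neg_self_of_ne_zero hε
  obtain ⟨γ', h₁, h₂⟩ := γ.exists_modification {i, j} (fun s => if s = i then j else i)
    (fun _ => 0) (by simp [hgi, hgj]) (by simp [hij.ne']) (by simp [hij.ne, hij.ne'])
    (by rw [Finset.sum_pair hij.ne, Finset.sum_pair hij.ne, hi, hj]; simp)
  simp only [Finset.forall_mem_insert, Finset.mem_singleton, forall_eq, hij.ne', if_true,
    if_false] at h₁
  obtain ⟨⟨hmi, hsi⟩, hmj, hsj⟩ := h₁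
  have key := lt_of_ranks (γ' := γ') h (fun h => by simp [← h, hgi, hij.ne] at hmi)
    (fun δ x => if δ = ε ∧ i ≤ x ∧ x < j then 1 else 0)
    (fun x y => if i ≤ x ∧ y < j then 1 else 0)
    (fun δ x hδ => by
      have := signRank_of_agreeOff h₂ δ x
      rw [Finset.sum_pair hij.ne, hmi, hmj, hsi, hsj, hgi, hgj, hi, hj] at this
      rcases eq_or_eq_neg hε hδ with rfl | rfl <;> grind)
    (fun x y hxy => by
      have := rankPair_of_agreeOff h₂ x y
      rw [Finset.sum_pair hij.ne, hmi, hmj, hgi, hgj] at this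
      grind)
    (by grind) (by grind)
  refine ⟨γ', key.1, key.2, ?_⟩
  replace h₂ : AgreeOff {i, j} γ γ' := by simpa using h₂
  rcases eq_or_eq_neg (ε := 1) (by decide) hε with rfl | rfl
  · exact .plus_minus i j hij ⟨hi, hj⟩ hmi h₂
  · exact .minus_plus i j hij ⟨hi, by simpa using hj⟩ hmi h₂

/-- The sign `ε` travels from `i` to `j`, so its count is missing exactly on `[i, j)`. -/
theorem exists_move_sign_pair {γ τ : Clan p q} (h : γ ≤ τ) {ε : SignType} (hε : ε ≠ 0)
    {i j k : Fin (p + q)} (hij : i < j) (hjk : j < k) (hsi : γ.sign i = ε) (hgj : γ.mate j = k)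
    (hs : ∀ x, i ≤ x → x < j → τ.signRank ε x + 1 ≤ γ.signRank ε x)
    (hp : ∀ x y, x < y → i ≤ x → x < j → y < k → γ.rankPair x y + 1 ≤ τ.rankPair x y) :
    ∃ γ', γ < γ' ∧ γ' ≤ τ ∧ Move γ γ' := by
  have hgi := γ.mate_eq_self hε hsi
  have hgk := γ.mate_eq_comm.1 hgj
  have hsj := (γ.sign_eq_zero_iff j).2 (hgj ▸ hjk.ne')
  have hsk := (γ.sign_eq_zero_iff k).2 (hgk ▸ hjk.ne)
  have hik := hij.trans hjk
  have hne := ne_neg_self_of_ne_zero hε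
  have hsum : ∀ F : Fin (p + q) → ℤ, ∑ s ∈ {i, j, k}, F s = F i + F j + F k := fun F => by
    rw [Finset.sum_insert (by simp [hij.ne, hik.ne]), Finset.sum_pair hjk.ne, add_assoc]
  obtain ⟨γ', h₁, h₂⟩ := γ.exists_modification {i, j, k}
    (fun s => if s = i then k else if s = k then i else j)
    (fun s => if s = j then ε else 0) (by simp [hgi, hgj, hgk])
    (by simp [hij.ne, hij.ne', hik.ne', hjk.ne, hjk.ne', hik.ne])
    (by simp [hij.ne, hij.ne', hik.ne', hjk.ne, hjk.ne', hik.ne, hε])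
    (by rw [hsum, hsum, hsi, hsj, hsk]; simp [hij.ne, hjk.ne'])
  simp only [Finset.forall_mem_insert, Finset.mem_singleton, forall_eq, hij.ne', hij.ne, hik.ne',
    hjk.ne, hjk.ne', if_true, if_false] at h₁
  obtain ⟨⟨hmi, hti⟩, ⟨hmj, htj⟩, hmk, htk⟩ := h₁
  have key := lt_of_ranks (γ' := γ') h (fun h => by rw [← h, hgi] at hmi; grind)
    (fun δ x => if δ = ε ∧ i ≤ x ∧ x < j then 1 else 0)
    (fun x y => if i ≤ x ∧ x < j ∧ y < k then 1 else 0)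
    (fun δ x hδ => by
      have := signRank_of_agreeOff h₂ δ x
      rw [hsum, hmi, hmj, hmk, hti, htj, htk, hgi, hgj, hgk, hsi, hsj, hsk] at this
      rcases eq_or_eq_neg hε hδ with rfl | rfl <;> grind)
    (fun x y hxy => by
      have := rankPair_of_agreeOff h₂ x y
      rw [hsum, hmi, hmj, hmk, hgi, hgj, hgk] at this
      grind)
    (by grind) (by grind)
  refine ⟨γ', key.1, key.2, ?_⟩
  replace h₂ : AgreeOff {i, j, k} γ γ' := by simpa using h₂
  rcases eq_or_eq_neg (ε := 1) (by decide) hε with rfl | rfl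
  · exact .plus_pair i j k hij hjk ⟨hsi, hgj⟩ ⟨hmi, htj⟩ h₂
  · exact .minus_pair i j k hij hjk ⟨hsi, hgj⟩ ⟨hmi, htj⟩ h₂

/-- At `j` a second occurrence, which counts for both signs, becomes `ε`; the count for `-ε` returns
only at `k`. -/
theorem exists_move_pair_sign {γ τ : Clan p q} (h : γ ≤ τ) {ε : SignType} (hε : ε ≠ 0)
    {i j k : Fin (p + q)} (hij : i < j) (hjk : j < k) (hgi : γ.mate i = j) (hsk : γ.sign k = ε)
    (hs : ∀ x, j ≤ x → x < k → τ.signRank (-ε) x + 1 ≤ γ.signRank (-ε) x)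
    (hp : ∀ x y, x < y → i ≤ x → j ≤ y → y < k → γ.rankPair x y + 1 ≤ τ.rankPair x y) :
    ∃ γ', γ < γ' ∧ γ' ≤ τ ∧ Move γ γ' := by
  have hgk := γ.mate_eq_self hε hsk
  have hgj := γ.mate_eq_comm.1 hgi
  have hsi := (γ.sign_eq_zero_iff i).2 (hgi ▸ hij.ne')
  have hsj := (γ.sign_eq_zero_iff j).2 (hgj ▸ hij.ne)
  have hik := hij.trans hjk
  have hne := ne_neg_self_of_ne_zero hε
  have hsum : ∀ F : Fin (p + q) → ℤ, ∑ s ∈ {i, j, k}, F s = F i + F j + F k := fun F => by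
    rw [Finset.sum_insert (by simp [hij.ne, hik.ne]), Finset.sum_pair hjk.ne, add_assoc]
  obtain ⟨γ', h₁, h₂⟩ := γ.exists_modification {i, j, k}
    (fun s => if s = i then k else if s = k then i else j)
    (fun s => if s = j then ε else 0) (by simp [hgi, hgj, hgk])
    (by simp [hij.ne, hij.ne', hik.ne', hjk.ne, hjk.ne', hik.ne])
    (by simp [hij.ne, hij.ne', hik.ne', hjk.ne, hjk.ne', hik.ne, hε])
    (by rw [hsum, hsum, hsi, hsj, hsk]; simp [hij.ne, hjk.ne'])
  simp only [Finset.forall_mem_insert, Finset.mem_singleton, forall_eq, hij.ne', hij.ne, hik.ne',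
    hjk.ne, hjk.ne', if_true, if_false] at h₁
  obtain ⟨⟨hmi, hti⟩, ⟨hmj, htj⟩, hmk, htk⟩ := h₁
  have key := lt_of_ranks (γ' := γ') h (fun h => by rw [← h, hgi] at hmi; grind)
    (fun δ x => if δ = -ε ∧ j ≤ x ∧ x < k then 1 else 0)
    (fun x y => if i ≤ x ∧ j ≤ y ∧ y < k then 1 else 0)
    (fun δ x hδ => by
      have := signRank_of_agreeOff h₂ δ x
      rw [hsum, hmi, hmj, hmk, hti, htj, htk, hgi, hgj, hgk, hsi, hsj, hsk] at this
      rcases eq_or_eq_neg hε hδ with rfl | rfl <;> grind)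
    (fun x y hxy => by
      have := rankPair_of_agreeOff h₂ x y
      rw [hsum, hmi, hmj, hmk, hgi, hgj, hgk] at this
      grind)
    (by grind) (by grind)
  refine ⟨γ', key.1, key.2, ?_⟩
  replace h₂ : AgreeOff {i, j, k} γ γ' := by simpa using h₂
  rcases eq_or_eq_neg (ε := 1) (by decide) hε with rfl | rfl
  · exact .pair_plus i j k hij hjk ⟨hgi, hsk⟩ ⟨hmi, htj⟩ h₂
  · exact .pair_minus i j k hij hjk ⟨hgi, hsk⟩ ⟨hmi, htj⟩ h₂

theorem exists_move_join {γ τ : Clan p q} (h : γ ≤ τ) {ε : SignType} (hε : ε ≠ 0)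
    {i j k l : Fin (p + q)} (hij : i < j) (hjk : j < k) (hkl : k < l)
    (hgi : γ.mate i = j) (hgk : γ.mate k = l)
    (hs : ∀ x, j ≤ x → x < k → τ.signRank (-ε) x + 1 ≤ γ.signRank (-ε) x)
    (hp : ∀ x y, x < y → i ≤ x → x < k → j ≤ y → y < l →
      γ.rankPair x y + 1 ≤ τ.rankPair x y) :
    ∃ γ', γ < γ' ∧ γ' ≤ τ ∧ Move γ γ' := by
  have hgj := γ.mate_eq_comm.1 hgi
  have hgl := γ.mate_eq_comm.1 hgk
  have hsi := (γ.sign_eq_zero_iff i).2 (hgi ▸ hij.ne')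
  have hsj := (γ.sign_eq_zero_iff j).2 (hgj ▸ hij.ne)
  have hsk := (γ.sign_eq_zero_iff k).2 (hgk ▸ hkl.ne')
  have hsl := (γ.sign_eq_zero_iff l).2 (hgl ▸ hkl.ne)
  have hne := ne_neg_self_of_ne_zero hε
  have hik := hij.trans hjk
  have hjl := hjk.trans hkl
  have hil := hij.trans hjl
  have hsum : ∀ F : Fin (p + q) → ℤ,
      ∑ s ∈ {i, j, k, l}, F s = F i + F j + F k + F l := fun F => by
    rw [Finset.sum_insert (by simp [hij.ne, hik.ne, hil.ne]),
      Finset.sum_insert (by simp [hjk.ne, hjl.ne]), Finset.sum_pair hkl.ne]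
    ring
  obtain ⟨γ', h₁, h₂⟩ := γ.exists_modification {i, j, k, l}
    (fun s => if s = i then l else if s = l then i else s)
    (fun s => if s = j then ε else if s = k then -ε else 0) (by simp [hgi, hgj, hgk, hgl])
    (by simp [hij.ne, hij.ne', hik.ne', hjk.ne, hjk.ne', hik.ne, hil.ne, hil.ne', hjl.ne, hjl.ne',
      hkl.ne, hkl.ne'])
    (by simp [hij.ne, hij.ne', hik.ne', hjk.ne', hik.ne, hil.ne, hil.ne', hjl.ne, hjl.ne',
      hkl.ne, hkl.ne', hε, neg_ne_zero_of_ne_zero hε])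
    (by
      rw [hsum, hsum, hsi, hsj, hsk, hsl]
      simp [hij.ne, hik.ne, hjk.ne', hjl.ne', hkl.ne'])
  simp only [Finset.forall_mem_insert, Finset.mem_singleton, forall_eq, hij.ne', hij.ne, hik.ne',
    hik.ne, hil.ne, hil.ne', hjl.ne, hjl.ne', hkl.ne, hkl.ne', hjk.ne, hjk.ne', if_true,
    if_false] at h₁
  obtain ⟨⟨hmi, hti⟩, ⟨hmj, htj⟩, ⟨hmk, htk⟩, hml, htl⟩ := h₁
  have key := lt_of_ranks (γ' := γ') h (fun h => by rw [← h, hgi] at hmi; grind)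
    (fun δ x => if δ = -ε ∧ j ≤ x ∧ x < k then 1 else 0)
    (fun x y => if i ≤ x ∧ x < k ∧ j ≤ y ∧ y < l then 1 else 0)
    (fun δ x hδ => by
      have := signRank_of_agreeOff h₂ δ x
      rw [hsum, hmi, hmj, hmk, hml, hti, htj, htk, htl, hgi, hgj, hgk, hgl, hsi, hsj, hsk,
        hsl] at this
      rcases eq_or_eq_neg hε hδ with rfl | rfl <;> grind)
    (fun x y hxy => by
      have := rankPair_of_agreeOff h₂ x y
      rw [hsum, hmi, hmj, hmk, hml, hgi, hgj, hgk, hgl] at this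
      grind)
    (by grind) (by grind)
  refine ⟨γ', key.1, key.2, ?_⟩
  replace h₂ : AgreeOff {i, j, k, l} γ γ' := by simpa using h₂
  rcases eq_or_eq_neg (ε := 1) (by decide) hε with rfl | rfl
  · exact .join_plus_minus i j k l hij hjk hkl ⟨hgi, hgk⟩ ⟨hmi, htj, htk⟩ h₂
  · exact .join_minus_plus i j k l hij hjk hkl ⟨hgi, hgk⟩ ⟨hmi, htj, by simpa using htk⟩ h₂

/-- Both pairs are lengthened, and the regions where the pair rank rises overlap when `j ≤ x` and `y
< k`. There it rises by 2, whence `hp'`. -/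
theorem exists_move_cross {γ τ : Clan p q} (h : γ ≤ τ)
    {i j k l : Fin (p + q)} (hij : i < j) (hjk : j < k) (hkl : k < l)
    (hgi : γ.mate i = j) (hgk : γ.mate k = l)
    (hs : ∀ δ x, δ ≠ 0 → j ≤ x → x < k → τ.signRank δ x + 1 ≤ γ.signRank δ x)
    (hp : ∀ x y, x < y → i ≤ x → x < k → j ≤ y → y < l → x < j ∧ y < k ∨ j ≤ x ∧ k ≤ y →
      γ.rankPair x y + 1 ≤ τ.rankPair x y)
    (hp' : ∀ x y, x < y → j ≤ x → y < k → γ.rankPair x y + 2 ≤ τ.rankPair x y) :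
    ∃ γ', γ < γ' ∧ γ' ≤ τ ∧ Move γ γ' := by
  have hgj := γ.mate_eq_comm.1 hgi
  have hgl := γ.mate_eq_comm.1 hgk
  have hsi := (γ.sign_eq_zero_iff i).2 (hgi ▸ hij.ne')
  have hsj := (γ.sign_eq_zero_iff j).2 (hgj ▸ hij.ne)
  have hsk := (γ.sign_eq_zero_iff k).2 (hgk ▸ hkl.ne')
  have hsl := (γ.sign_eq_zero_iff l).2 (hgl ▸ hkl.ne)
  have hik := hij.trans hjk
  have hjl := hjk.trans hkl
  have hil := hij.trans hjl
  have hsum : ∀ F : Fin (p + q) → ℤ,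
      ∑ s ∈ {i, j, k, l}, F s = F i + F j + F k + F l := fun F => by
    rw [Finset.sum_insert (by simp [hij.ne, hik.ne, hil.ne]),
      Finset.sum_insert (by simp [hjk.ne, hjl.ne]), Finset.sum_pair hkl.ne]
    ring
  obtain ⟨γ', h₁, h₂⟩ := γ.exists_modification {i, j, k, l}
    (fun s => if s = i then k else if s = k then i else if s = j then l else j)
    (fun _ => 0) (by simp [hgi, hgj, hgk, hgl])
    (by simp [hij.ne, hij.ne', hik.ne', hjk.ne, hjk.ne', hik.ne, hil.ne, hil.ne', hjl.ne, hjl.ne',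
      hkl.ne, hkl.ne'])
    (by simp [hij.ne', hik.ne', hjk.ne, hik.ne, hil.ne', hjl.ne, hjl.ne',
      hkl.ne'])
    (by rw [hsum, hsum, hsi, hsj, hsk, hsl])
  simp only [Finset.forall_mem_insert, Finset.mem_singleton, forall_eq, hij.ne', hij.ne, hik.ne',
    hik.ne, hil.ne', hjl.ne', hkl.ne', hjk.ne, hjk.ne', if_true,
    if_false] at h₁
  obtain ⟨⟨hmi, hti⟩, ⟨hmj, htj⟩, ⟨hmk, htk⟩, hml, htl⟩ := h₁
  have key := lt_of_ranks (γ' := γ') h (fun h => by rw [← h, hgi] at hmi; grind)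
    (fun δ x => if δ ≠ 0 ∧ j ≤ x ∧ x < k then 1 else 0)
    (fun x y => (if i ≤ x ∧ j ≤ y ∧ y < k then 1 else 0) +
      if j ≤ x ∧ x < k ∧ y < l then 1 else 0)
    (fun δ x hδ => by
      have := signRank_of_agreeOff h₂ δ x
      rw [hsum, hmi, hmj, hmk, hml, hti, htj, htk, htl, hgi, hgj, hgk, hgl, hsi, hsj, hsk,
        hsl] at this
      grind)
    (fun x y hxy => by
      have := rankPair_of_agreeOff h₂ x y
      rw [hsum, hmi, hmj, hmk, hml, hgi, hgj, hgk, hgl] at this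
      grind)
    (by grind) (by grind)
  refine ⟨γ', key.1, key.2, ?_⟩
  replace h₂ : AgreeOff {i, j, k, l} γ γ' := by simpa using h₂
  exact .cross i j k l hij hjk hkl ⟨hgi, hgk⟩ ⟨hmi, hmj⟩ h₂

/-- Second occurrences stay at `k` and `l`, so no sign rank changes. -/
theorem exists_move_nest {γ τ : Clan p q} (h : γ ≤ τ)
    {i j k l : Fin (p + q)} (hij : i < j) (hjk : j < k) (hkl : k < l)
    (hgi : γ.mate i = k) (hgj : γ.mate j = l)
    (hp : ∀ x y, x < y → i ≤ x → x < j → k ≤ y → y < l →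
      γ.rankPair x y + 1 ≤ τ.rankPair x y) :
    ∃ γ', γ < γ' ∧ γ' ≤ τ ∧ Move γ γ' := by
  have hgk := γ.mate_eq_comm.1 hgi
  have hgl := γ.mate_eq_comm.1 hgj
  have hsi := (γ.sign_eq_zero_iff i).2 (hgi ▸ (hij.trans hjk).ne')
  have hsj := (γ.sign_eq_zero_iff j).2 (hgj ▸ (hjk.trans hkl).ne')
  have hsk := (γ.sign_eq_zero_iff k).2 (hgk ▸ (hij.trans hjk).ne)
  have hsl := (γ.sign_eq_zero_iff l).2 (hgl ▸ (hjk.trans hkl).ne)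
  have hik := hij.trans hjk
  have hjl := hjk.trans hkl
  have hil := hij.trans hjl
  have hsum : ∀ F : Fin (p + q) → ℤ,
      ∑ s ∈ {i, j, k, l}, F s = F i + F j + F k + F l := fun F => by
    rw [Finset.sum_insert (by simp [hij.ne, hik.ne, hil.ne]),
      Finset.sum_insert (by simp [hjk.ne, hjl.ne]), Finset.sum_pair hkl.ne]
    ring
  obtain ⟨γ', h₁, h₂⟩ := γ.exists_modification {i, j, k, l}
    (fun s => if s = i then l else if s = l then i else if s = j then k else j)
    (fun _ => 0) (by simp [hgi, hgj, hgk, hgl])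
    (by simp [hij.ne, hij.ne', hik.ne', hjk.ne, hjk.ne', hik.ne, hil.ne, hil.ne', hjl.ne, hjl.ne',
      hkl.ne, hkl.ne'])
    (by simp [hij.ne', hik.ne', hjk.ne, hjk.ne', hil.ne, hil.ne', hjl.ne,
      hkl.ne])
    (by rw [hsum, hsum, hsi, hsj, hsk, hsl])
  simp only [Finset.forall_mem_insert, Finset.mem_singleton, forall_eq, hij.ne', hij.ne, hik.ne',
    hil.ne, hil.ne', hjl.ne, hjl.ne', hkl.ne, hjk.ne', if_true,
    if_false] at h₁
  obtain ⟨⟨hmi, hti⟩, ⟨hmj, htj⟩, ⟨hmk, htk⟩, hml, htl⟩ := h₁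
  have key := lt_of_ranks (γ' := γ') h (fun h => by rw [← h, hgi] at hmi; grind)
    (fun δ x => 0)
    (fun x y => if i ≤ x ∧ x < j ∧ k ≤ y ∧ y < l then 1 else 0)
    (fun δ x hδ => by
      have := signRank_of_agreeOff h₂ δ x
      rw [hsum, hmi, hmj, hmk, hml, hti, htj, htk, htl, hgi, hgj, hgk, hgl, hsi, hsj, hsk,
        hsl] at this
      grind)
    (fun x y hxy => by
      have := rankPair_of_agreeOff h₂ x y
      rw [hsum, hmi, hmj, hmk, hml, hgi, hgj, hgk, hgl] at this
      grind)
    (by grind) (by grind)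
  refine ⟨γ', key.1, key.2, ?_⟩
  replace h₂ : AgreeOff {i, j, k, l} γ γ' := by simpa using h₂
  exact .nest i j k l hij hjk hkl ⟨hgi, hgj⟩ ⟨hmi, hmj⟩ h₂

/-! ### Comparing ranks along intervals -/

theorem rankPair_eq_add (τ : Clan p q) (i : Fin (p + q)) {l m : Fin (p + q)} (h : l ≤ m) :
    τ.rankPair i l = τ.rankPair i m +
      (Finset.univ.filter fun s => s ≤ i ∧ l < τ.mate s ∧ τ.mate s ≤ m).card := by
  unfold rankPair
  rw [← Finset.card_union_of_disjoint]
  · congr 1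
    ext s
    simp only [Finset.mem_union, Finset.mem_filter, Finset.mem_univ, true_and]
    grind
  · rw [Finset.disjoint_filter]
    grind

/-- Pairs of `γ` opened by `i` and closing in `(l, m]` all start before `f`, so `τ` has them too;
`τ` has in addition the pair `f, m`. -/
theorem rankPair_add_one_le {γ τ : Clan p q} {f i l m : Fin (p + q)}
    (agree : ∀ s < f, γ.mate s = τ.mate s) (hm : τ.mate f = m) (hfi : f ≤ i) (hlm : l < m)
    (hfl : γ.mate f ≤ l) (hno : ∀ s, f < s → s ≤ i → l < γ.mate s → m < γ.mate s)
    (h : γ.rankPair i m ≤ τ.rankPair i m) : γ.rankPair i l + 1 ≤ τ.rankPair i l := by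
  rw [rankPair_eq_add γ i hlm.le, rankPair_eq_add τ i hlm.le, add_assoc]
  refine add_le_add h (Finset.card_lt_card (Finset.ssubset_iff.2 ⟨f, by simp [hfl], ?_⟩))
  intro s
  simp only [Finset.mem_insert, Finset.mem_filter, Finset.mem_univ, true_and]
  grind

theorem signRank_eq_add (τ : Clan p q) (δ : SignType) {u v : Fin (p + q)} (h : u ≤ v) :
    τ.signRank δ v = τ.signRank δ u +
      (Finset.univ.filter fun s => (u < s ∧ s ≤ v) ∧ (τ.sign s = δ ∨ τ.mate s < s)).card := by
  unfold signRank
  rw [← Finset.card_union_of_disjoint]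
  · congr 1
    ext s
    simp only [Finset.mem_union, Finset.mem_filter, Finset.mem_univ, true_and]
    grind
  · rw [Finset.disjoint_filter]
    grind

/-- In other words, the excess of `γ` over `τ` does not grow from `u` to `v`. -/
theorem signRank_add_le {γ τ : Clan p q} {δ : SignType} {u v : Fin (p + q)} (huv : u ≤ v)
    (h : ∀ x, u < x → x ≤ v → γ.sign x = δ ∨ γ.mate x < x → τ.sign x = δ ∨ τ.mate x < x) :
    γ.signRank δ v + τ.signRank δ u ≤ τ.signRank δ v + γ.signRank δ u := by
  rw [signRank_eq_add γ δ huv, signRank_eq_add τ δ huv]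
  have := Finset.card_le_card (Finset.monotone_filter_right Finset.univ
    (p := fun s => (u < s ∧ s ≤ v) ∧ (γ.sign s = δ ∨ γ.mate s < s))
    (q := fun s => (u < s ∧ s ≤ v) ∧ (τ.sign s = δ ∨ τ.mate s < s))
    fun s _ hs => ⟨hs.1, h s hs.1.1 hs.1.2 hs.2⟩)
  omega

theorem signRank_add_lt {γ τ : Clan p q} {δ : SignType} {u v x₀ : Fin (p + q)}
    (h : ∀ x, u < x → x ≤ v → γ.sign x = δ ∨ γ.mate x < x → τ.sign x = δ ∨ τ.mate x < x)
    (hu : u < x₀) (hv : x₀ ≤ v) (hγ : ¬(γ.sign x₀ = δ ∨ γ.mate x₀ < x₀))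
    (hτ : τ.sign x₀ = δ ∨ τ.mate x₀ < x₀) :
    γ.signRank δ v + τ.signRank δ u < τ.signRank δ v + γ.signRank δ u := by
  rw [signRank_eq_add γ δ (hu.le.trans hv), signRank_eq_add τ δ (hu.le.trans hv)]
  have : (Finset.univ.filter fun s => (u < s ∧ s ≤ v) ∧ (γ.sign s = δ ∨ γ.mate s < s)).card <
      (Finset.univ.filter fun s => (u < s ∧ s ≤ v) ∧ (τ.sign s = δ ∨ τ.mate s < s)).card := by
    refine Finset.card_lt_card (Finset.ssubset_iff.2 ⟨x₀, by simp [hγ], ?_⟩)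
    intro s
    simp only [Finset.mem_insert, Finset.mem_filter, Finset.mem_univ, true_and]
    grind
  omega

theorem rankPair_eq_add_left (τ : Clan p q) {i v : Fin (p + q)} (l : Fin (p + q)) (h : i ≤ v) :
    τ.rankPair v l = τ.rankPair i l +
      (Finset.univ.filter fun s => (i < s ∧ s ≤ v) ∧ l < τ.mate s).card := by
  unfold rankPair
  rw [← Finset.card_union_of_disjoint]
  · congr 1
    ext s
    simp only [Finset.mem_union, Finset.mem_filter, Finset.mem_univ, true_and]
    grind
  · rw [Finset.disjoint_filter]
    grind

theorem rankPair_add_le {γ τ : Clan p q} {i v l : Fin (p + q)} (hiv : i ≤ v)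
    (h : ∀ s, i < s → s ≤ v → l < τ.mate s → l < γ.mate s) :
    τ.rankPair v l + γ.rankPair i l ≤ γ.rankPair v l + τ.rankPair i l := by
  rw [rankPair_eq_add_left γ l hiv, rankPair_eq_add_left τ l hiv]
  have := Finset.card_le_card (Finset.monotone_filter_right Finset.univ
    (p := fun s => (i < s ∧ s ≤ v) ∧ l < τ.mate s)
    (q := fun s => (i < s ∧ s ≤ v) ∧ l < γ.mate s)
    fun s _ hs => ⟨hs.1, h s hs.1.1 hs.1.2 hs.2⟩)
  omega

theorem rankPair_add_lt {γ τ : Clan p q} {i v l x₀ : Fin (p + q)}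
    (h : ∀ s, i < s → s ≤ v → l < τ.mate s → l < γ.mate s)
    (hi : i < x₀) (hv : x₀ ≤ v) (hτ : ¬l < τ.mate x₀) (hγ : l < γ.mate x₀) :
    τ.rankPair v l + γ.rankPair i l < γ.rankPair v l + τ.rankPair i l := by
  rw [rankPair_eq_add_left γ l (hi.le.trans hv), rankPair_eq_add_left τ l (hi.le.trans hv)]
  have : (Finset.univ.filter fun s => (i < s ∧ s ≤ v) ∧ l < τ.mate s).card <
      (Finset.univ.filter fun s => (i < s ∧ s ≤ v) ∧ l < γ.mate s).card := by
    refine Finset.card_lt_card (Finset.ssubset_iff.2 ⟨x₀, by simp [hτ], ?_⟩)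
    intro s
    simp only [Finset.mem_insert, Finset.mem_filter, Finset.mem_univ, true_and]
    grind
  omega

theorem signRank_congr {γ τ : Clan p q} {δ : SignType} {i : Fin (p + q)}
    (h : ∀ s ≤ i, (γ.sign s = δ ∨ γ.mate s < s) ↔ (τ.sign s = δ ∨ τ.mate s < s)) :
    γ.signRank δ i = τ.signRank δ i := by
  unfold signRank
  congr 1
  ext s
  simp only [Finset.mem_filter, Finset.mem_univ, true_and]
  exact and_congr_right (h s)

theorem rankPair_diag_eq {γ τ : Clan p q} {ε : SignType} (hε : ε ≠ 0) (i : Fin (p + q)) :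
    γ.signRank ε i + γ.signRank (-ε) i + γ.rankPair i i =
      τ.signRank ε i + τ.signRank (-ε) i + τ.rankPair i i := by
  rw [γ.signRank_add_signRank_neg hε, τ.signRank_add_signRank_neg hε]

/-! ### The choice of the move -/

theorem exists_first {n : ℕ} {P : Fin n → Prop} (h : ∃ j, P j) : ∃ j, P j ∧ ∀ x < j, ¬P x := by
  obtain ⟨j, hj, hmin⟩ := wellFounded_lt.has_min {j | P j} h
  exact ⟨j, hj, fun x hx hPx => hmin x hPx hx⟩

theorem mate_eq_of_mate_lt {γ τ : Clan p q} {f : Fin (p + q)}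
    (agree : ∀ s < f, γ.mate s = τ.mate s) {x : Fin (p + q)} (hx : γ.mate x < f) :
    τ.mate x = γ.mate x := by
  rw [mate_eq_comm, ← agree _ hx, γ.mate_mate]

/-- The case in which the first difference is a sign of `γ` facing a first occurrence of `τ`. -/
theorem exists_move_of_sign {γ τ : Clan p q} (h : γ ≤ τ) {f m : Fin (p + q)}
    (agree : ∀ s < f, γ.mate s = τ.mate s) (agree' : ∀ s < f, γ.sign s = τ.sign s)
    {ε : SignType} (hε : ε ≠ 0) (hf : γ.sign f = ε) (hm : τ.mate f = m) (hfm : f < m) :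
    ∃ γ', γ < γ' ∧ γ' ≤ τ ∧ Move γ γ' := by
  have hε' := neg_ne_zero_of_ne_zero hε
  have hne := ne_neg_self_of_ne_zero hε
  have hgf := γ.mate_eq_self hε hf
  have htm := τ.mate_eq_comm.1 hm
  have htf : τ.sign f = 0 := (τ.sign_eq_zero_iff f).2 (hm ▸ hfm.ne')
  obtain ⟨hle, hpair⟩ := (le_iff _ _).1 h
  have back := fun x => mate_eq_of_mate_lt (x := x) agree
  have hstart : γ.signRank (-ε) f = τ.signRank (-ε) f := signRank_congr fun s hs => by
    rcases hs.lt_or_eq with hs | rfl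
    · rw [agree s hs, agree' s hs]
    · simp [hf, hgf, hne, htf, hε'.symm, hm, hfm.not_gt]
  have hinner : ∀ x, f < x → x ≤ m → γ.mate x < x → ¬ γ.mate x < f →
      f < γ.mate x ∧ γ.mate x < m := fun x hx hxm hlt hnlt => by
    refine ⟨lt_of_le_of_ne (not_lt.1 hnlt) fun h => ?_, hlt.trans_le hxm⟩
    rw [eq_comm, mate_eq_comm, hgf] at h
    exact hx.ne h
  obtain ⟨j, ⟨hfj, hjm, hj⟩, hfirst⟩ := exists_first
    (P := fun j => f < j ∧ j ≤ m ∧ (γ.sign j = -ε ∨ j < γ.mate j ∧ γ.mate j ≤ m)) (by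
      -- Otherwise every position of `γ` in `(f, m]` counted for `-ε` closes a pair opened before
      -- `f`, shared with `τ`. As `τ` also closes a pair at `m`, its rank there would be too large.
      by_contra! hno
      have := signRank_add_lt (γ := γ) (τ := τ) (δ := -ε) (u := f) (v := m) (x₀ := m)
        (fun x hx hxm hγ => by
          rcases hγ with hγ | hγ
          · exact absurd hγ (hno x hx hxm).1
          · by_cases hb : γ.mate x < f
            · rw [back x hb]; exact .inr hγ
            · obtain ⟨h₁, h₂⟩ := hinner x hx hxm hγ hb
              have := (hno _ h₁ h₂.le).2
              rw [γ.mate_mate] at this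
              exact absurd (this hγ) hxm.not_gt)
        hfm le_rfl
        (fun hγ => by
          rcases hγ with hγ | hγ
          · exact (hno m hfm le_rfl).1 hγ
          · by_cases hb : γ.mate m < f
            · have := back m hb
              grind
            · obtain ⟨h₁, h₂⟩ := hinner m hfm le_rfl hγ hb
              have := (hno _ h₁ h₂.le).2
              rw [γ.mate_mate] at this
              exact (this hγ).false)
        (.inr (htm ▸ hfm))
      have := hle (-ε) hε' m
      omega)
  have hpos : ∀ x y, f ≤ x → x < j → x ≤ y → y < m → γ.rankPair x y + 1 ≤ τ.rankPair x y :=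
    fun x y hfx hxj hxy hym => rankPair_add_one_le agree hm hfx hym (hgf.trans_le (hfx.trans hxy))
      (fun s hs hsx hys => by
        by_contra! hsm
        exact hfirst s (hsx.trans_lt hxj)
          ⟨hs, (hsx.trans hxy).trans hym.le, .inr ⟨(hsx.trans hxy).trans_lt hys, hsm⟩⟩)
      (hpair x m (hxy.trans_lt hym))
  -- The pair rank of `τ` is larger and its `-ε` rank is not smaller, so the diagonal identity makes
  -- its `ε` rank smaller.
  have hsgn : ∀ x, f ≤ x → x < j → τ.signRank ε x + 1 ≤ γ.signRank ε x := fun x hfx hxj => by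
    have h₁ := hpos x x hfx hxj le_rfl (hxj.trans_le hjm)
    have h₂ := rankPair_diag_eq (γ := γ) (τ := τ) hε x
    have h₃ := signRank_add_le (γ := γ) (τ := τ) (δ := -ε) hfx fun y hy hyx hγ => by
      have hno := hfirst y (hyx.trans_lt hxj)
      have hym := hyx.trans (hxj.le.trans hjm)
      rcases hγ with hγ | hγ
      · exact absurd ⟨hy, hym, .inl hγ⟩ hno
      · by_cases hb : γ.mate y < f
        · rw [back y hb]; exact .inr hγ
        · obtain ⟨h₁, h₂⟩ := hinner y hy hym hγ hb
          exact absurd ⟨h₁, h₂.le, .inr (by rw [γ.mate_mate]; exact ⟨hγ, hym⟩)⟩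
            (hfirst _ (hγ.trans (hyx.trans_lt hxj)))
    omega
  rcases hj with hj | ⟨hj, hjm'⟩
  · exact exists_move_sign_neg h hε hfj hf hj hsgn fun x y hxy hfx hyj =>
      hpos x y hfx (hxy.trans hyj) hxy.le (hyj.trans_le hjm)
  · exact exists_move_sign_pair h hε hfj hj hf rfl hsgn fun x y hxy hfx hxj hyj =>
      hpos x y hfx hxj hxy.le (hyj.trans_le hjm')

/-- The case in which the first difference is a first occurrence in both clans. -/
theorem exists_move_of_pair {γ τ : Clan p q} (h : γ ≤ τ) {f a m : Fin (p + q)}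
    (agree : ∀ s < f, γ.mate s = τ.mate s)
    (ha : γ.mate f = a) (hm : τ.mate f = m) (hfa : f < a) (ham : a < m) :
    ∃ γ', γ < γ' ∧ γ' ≤ τ ∧ Move γ γ' := by
  have hga := γ.mate_eq_comm.1 ha
  have htm := τ.mate_eq_comm.1 hm
  obtain ⟨hle, hpair⟩ := (le_iff _ _).1 h
  have back := fun x => mate_eq_of_mate_lt (x := x) agree
  by_cases hnest : ∃ s, f < s ∧ s < a ∧ a < γ.mate s ∧ γ.mate s ≤ m
  · obtain ⟨s, ⟨hfs, hsa, has, hsm⟩, hfirst⟩ := exists_first hnest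
    refine exists_move_nest h hfs hsa has ha rfl fun x y hxy hfx hxs hay hys => ?_
    refine rankPair_add_one_le agree hm hfx (hys.trans_le hsm) (ha.trans_le hay) ?_
      (hpair x m (hxy.trans (hys.trans_le hsm)))
    intro t hft htx hyt
    by_contra! htm'
    exact hfirst t (htx.trans_lt hxs)
      ⟨hft, htx.trans_lt (hxs.trans hsa), hay.trans_lt hyt, htm'⟩
  push Not at hnest
  have hpos : ∀ x y, f ≤ x → x ≤ y → a ≤ y → y < m →
      (∀ s, a < s → s ≤ x → ¬ (s < γ.mate s ∧ γ.mate s ≤ m)) →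
      γ.rankPair x y + 1 ≤ τ.rankPair x y := fun x y hfx hxy hay hym hno => by
    refine rankPair_add_one_le agree hm hfx hym (ha.trans_le hay) ?_ (hpair x m (hxy.trans_lt hym))
    intro s hfs hsx hys
    rcases lt_trichotomy s a with hsa | rfl | has
    · exact hnest s hfs hsa (hay.trans_lt hys)
    · rw [hga] at hys
      exact absurd (hfa.trans_le hay) hys.not_gt
    · by_contra! hsm
      exact hno s has hsx ⟨(hsx.trans hxy).trans_lt hys, hsm⟩
  -- A pair closing in `(a, m]` cannot open between `f` and `a`, since nesting is excluded, nor
  -- after `a`; it is therefore shared with `τ`.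
  have hclose : ∀ x, a < x → x ≤ m → γ.mate x < x →
      (∀ s, a < s → s < x → ¬ (s < γ.mate s ∧ γ.mate s ≤ m)) → γ.mate x < f := by
    intro x hax hxm hx hno
    by_contra! hfx
    have hgx := γ.mate_mate x
    rcases hfx.lt_or_eq with hfx | hfx
    · rcases lt_trichotomy (γ.mate x) a with hxa | hxa | hxa
      · have := hnest _ hfx hxa (by rwa [hgx])
        rw [hgx] at this
        exact this.not_ge hxm
      · rw [hxa, hga] at hgx
        exact (hfa.trans hax).ne hgx
      · exact hno _ hxa hx (by rw [hgx]; exact ⟨hx, hxm⟩)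
    · rw [← hfx, ha] at hgx
      exact hax.ne hgx
  have hmono : ∀ δ u v, a ≤ u → u ≤ v → v ≤ m →
      (∀ s, a < s → s ≤ v → ¬ (γ.sign s = δ ∨ s < γ.mate s ∧ γ.mate s ≤ m)) →
      γ.signRank δ v + τ.signRank δ u ≤ τ.signRank δ v + γ.signRank δ u := by
    intro δ u v hau huv hvm hno
    refine signRank_add_le huv fun x hux hxv hx => ?_
    have hax := hau.trans_lt hux
    rcases hx with hx | hx
    · exact absurd (.inl hx) (hno x hax hxv)
    · rw [back x (hclose x hax (hxv.trans hvm) hx fun s has hsx hs =>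
        hno s has (hsx.le.trans hxv) (.inr hs))]
      exact .inr hx
  -- `τ` has a second occurrence at `m` that `γ` does not match, so the excess drops before or at
  -- `m`, where it is still nonnegative.
  have hstrict : ∀ δ u, δ ≠ 0 → a ≤ u → u < m →
      (∀ s, a < s → s ≤ m → ¬ (γ.sign s = δ ∨ s < γ.mate s ∧ γ.mate s ≤ m)) →
      τ.signRank δ u + 1 ≤ γ.signRank δ u := by
    intro δ u hδ hau hum hno
    have hc : ∀ x, u < x → x ≤ m → γ.mate x < x → γ.mate x < f := fun x hux hxm hx =>
      hclose x (hau.trans_lt hux) hxm hx fun s has hsx hs =>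
        hno s has (hsx.le.trans hxm) (.inr hs)
    have h₁ := signRank_add_lt (γ := γ) (τ := τ) (δ := δ) (u := u) (v := m) (x₀ := m)
      (fun x hux hxm hx => by
        rcases hx with hx | hx
        · exact absurd (.inl hx) (hno x (hau.trans_lt hux) hxm)
        · rw [back x (hc x hux hxm hx)]
          exact .inr hx)
      hum le_rfl
      (fun hγ => by
        rcases hγ with hγ | hγ
        · exact hno m ham le_rfl (.inl hγ)
        · have h₂ := hc m hum le_rfl hγ
          have h₃ := back m h₂
          rw [htm] at h₃
          exact h₂.ne h₃.symm)
      (.inr (htm ▸ hfa.trans ham))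
    have h₂ := hle δ hδ m
    omega
  have hfinish : ∀ δ j, δ ≠ 0 → a < j → j ≤ m → (γ.sign j = δ ∨ j < γ.mate j ∧ γ.mate j ≤ m) →
      (∀ s, a < s → s < j → ¬ (s < γ.mate s ∧ γ.mate s ≤ m)) →
      (∀ x, a ≤ x → x < j → τ.signRank (-δ) x + 1 ≤ γ.signRank (-δ) x) →
      ∃ γ', γ < γ' ∧ γ' ≤ τ ∧ Move γ γ' := by
    intro δ j hδ haj hjm hj hno hs
    rcases hj with hj | ⟨hj, hjm'⟩
    · exact exists_move_pair_sign h hδ hfa haj ha hj hs fun x y hxy hfx hay hyj =>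
        hpos x y hfx hxy.le hay (hyj.trans_le hjm) fun s has hsx =>
          hno s has (hsx.trans_lt (hxy.trans hyj))
    · exact exists_move_join h hδ hfa haj hj ha rfl hs fun x y hxy hfx hxj hay hyj =>
        hpos x y hfx hxy.le hay (hyj.trans_le hjm') fun s has hsx => hno s has (hsx.trans_lt hxj)
  by_cases hQ : ∃ j, a < j ∧ j ≤ m ∧ (γ.sign j ≠ 0 ∨ j < γ.mate j ∧ γ.mate j ≤ m)
  · obtain ⟨j, ⟨haj, hjm, hj⟩, hfirst⟩ := exists_first hQ
    have hfirst' : ∀ s, a < s → s < j → ¬ (γ.sign s ≠ 0 ∨ s < γ.mate s ∧ γ.mate s ≤ m) :=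
      fun s has hsj hs => hfirst s hsj ⟨has, hsj.le.trans hjm, hs⟩
    -- If `j` opens a pair, either sign can be tried first.
    obtain ⟨δ, hδ, hjδ⟩ : ∃ δ, δ ≠ 0 ∧ (γ.sign j = δ ∨ j < γ.mate j ∧ γ.mate j ≤ m) := by
      rcases hj with hj | hj
      exacts [⟨_, hj, .inl rfl⟩, ⟨1, by decide, .inr hj⟩]
    by_cases hall : ∀ x, a ≤ x → x < j → τ.signRank (-δ) x + 1 ≤ γ.signRank (-δ) x
    · exact hfinish δ j hδ haj hjm hjδ (fun s has hsj hs => hfirst' s has hsj (.inr hs)) hall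
    -- At `x₀` the `-δ` rank has no slack, so the diagonal identity gives slack for `δ`. The
    -- opposite sign is therefore used, with its own first candidate `j'`.
    push Not at hall
    obtain ⟨x₀, hax₀, hx₀j, hx₀⟩ := hall
    have hδ' := neg_ne_zero_of_ne_zero hδ
    have hQ' : ∃ j', a < j' ∧ j' ≤ m ∧ (γ.sign j' = -δ ∨ j' < γ.mate j' ∧ γ.mate j' ≤ m) := by
      by_contra! hno
      have := hstrict (-δ) x₀ hδ' hax₀ (hx₀j.trans_le hjm) fun s has hsm hs => by
        rcases hs with hs | hs
        exacts [(hno s has hsm).1 hs, hs.2.not_gt ((hno s has hsm).2 hs.1)]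
      omega
    obtain ⟨j', ⟨haj', hjm', hj'⟩, hfirst''⟩ := exists_first hQ'
    have hno' : ∀ s, a < s → s < j' → ¬ (γ.sign s = -δ ∨ s < γ.mate s ∧ γ.mate s ≤ m) :=
      fun s has hsj hs => hfirst'' s hsj ⟨has, hsj.le.trans hjm', hs⟩
    refine hfinish (-δ) j' hδ' haj' hjm' hj'
      (fun s has hsj hs => hno' s has hsj (.inr hs)) fun x hax hxj' => ?_
    rw [neg_neg]
    have hdiag := fun x => rankPair_diag_eq (γ := γ) (τ := τ) hδ x
    have hpos' : ∀ x, a ≤ x → x < j' → γ.rankPair x x + 1 ≤ τ.rankPair x x := fun x hax hxj' =>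
      hpos x x (hfa.le.trans hax) le_rfl hax (hxj'.trans_le hjm') fun s has hsx hs =>
        hno' s has (hsx.trans_lt hxj') (.inr hs)
    rcases le_total x₀ x with hx | hx
    -- To the right of `x₀` the lack of slack for `-δ` persists; to the left, the slack for `δ` at
    -- `x₀` propagates backwards.
    · have h₁ := hmono (-δ) x₀ x hax₀ hx (hxj'.le.trans hjm') fun s has hsx =>
        hno' s has (hsx.trans_lt hxj')
      have h₂ := hdiag x
      have h₃ := hpos' x hax hxj'
      omega
    · have hx₀j' : x₀ < j' := by
        refine hx₀j.trans_le (not_lt.1 fun hlt => hfirst' j' haj' hlt ?_)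
        exact hj'.elim (fun e => .inl (e ▸ hδ')) .inr
      have h₁ := hmono δ x x₀ hax hx (hx₀j.le.trans hjm) fun s has hsx hs =>
        hfirst' s has (hsx.trans_lt hx₀j) (hs.elim (fun e => .inl (e ▸ hδ)) .inr)
      have h₂ := hdiag x₀
      have h₃ := hpos' x₀ hax₀ hx₀j'
      omega
  -- Now every position of `γ` in `(a, m]` either closes a pair opened before `f` or opens one that
  -- closes after `m`.
  push Not at hQ
  have hsgn : ∀ δ x, δ ≠ 0 → a ≤ x → x < m → τ.signRank δ x + 1 ≤ γ.signRank δ x :=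
    fun δ x hδ hax hxm => hstrict δ x hδ hax hxm fun s has hsm hs => by
      rcases hs with hs | hs
      exacts [hδ (hs ▸ (hQ s has hsm).1), hs.2.not_gt ((hQ s has hsm).2 hs.1)]
  have hpos' : ∀ x y, f ≤ x → x ≤ y → a ≤ y → y < m → γ.rankPair x y + 1 ≤ τ.rankPair x y :=
    fun x y hfx hxy hay hym => hpos x y hfx hxy hay hym fun s has hsx hs =>
      hs.2.not_gt ((hQ s has (hsx.trans (hxy.trans hym.le))).2 hs.1)
  have hopen : ∀ s, a < s → s ≤ m → ¬ τ.mate s < s → s < γ.mate s := fun s has hsm hs => by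
    have hne := (γ.sign_eq_zero_iff s).1 (hQ s has hsm).1
    refine (lt_or_gt_of_ne hne).resolve_left fun hlt => hs ?_
    rwa [back s (hclose s has hsm hlt fun t hat hts ht =>
      ht.2.not_gt ((hQ t hat (hts.le.trans hsm)).2 ht.1))]
  have hmopen : m < γ.mate m := by
    have hne := (γ.sign_eq_zero_iff m).1 (hQ m ham le_rfl).1
    refine (lt_or_gt_of_ne hne).resolve_left fun hlt => ?_
    have h₁ := hclose m ham le_rfl hlt fun t hat hts ht =>
      ht.2.not_gt ((hQ t hat hts.le).2 ht.1)
    have h₂ := back m h₁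
    rw [htm] at h₂
    exact h₁.ne h₂.symm
  -- Choosing the earliest closing pair ensures that, for `y < γ.mate k`, every pair opened in `(a,
  -- m]` is still open beyond `y`.
  obtain ⟨k, ⟨hak, hkm, hk⟩, hmin⟩ := (measure fun s => (γ.mate s : ℕ)).wf.has_min
    {s | a < s ∧ s ≤ m ∧ s < γ.mate s} ⟨m, ham, le_rfl, hmopen⟩
  replace hmin : ∀ s, a < s → s ≤ m → s < γ.mate s → γ.mate k ≤ γ.mate s := fun s has hsm hs =>
    not_lt.1 (hmin s ⟨has, hsm, hs⟩)
  refine exists_move_cross h hfa hak hk ha rfl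
    (fun δ x hδ hax hxk => hsgn δ x hδ hax (hxk.trans_le hkm)) ?_ ?_
  · intro x y hxy hfx hxk hay hyl hcase
    by_cases hym : y < m
    · exact hpos' x y hfx hxy.le hay hym
    push Not at hym
    have hax : a ≤ x := by
      rcases hcase with hc | hc
      exacts [absurd (hc.2.trans_le hkm) hym.not_gt, hc.1]
    -- From `x` to `m` the lead of `τ` in open pairs strictly shrinks, because `m` is an opening for
    -- `γ` and a closing for `τ`; it is nonnegative at `m`.
    have h₁ := rankPair_add_lt (γ := γ) (τ := τ) (i := x) (v := m) (l := y) (x₀ := m)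
      (fun s hxs hsm hs => hyl.trans_le (hmin s (hax.trans_lt hxs) hsm
        (hopen s (hax.trans_lt hxs) hsm (hsm.trans (hym.trans hs.le)).not_gt)))
      (hxk.trans_le hkm) le_rfl (by rw [htm]; exact ((hfa.trans ham).le.trans hym).not_gt)
      (hyl.trans_le (hmin m ham le_rfl hmopen))
    have h₂ : γ.rankPair m y ≤ τ.rankPair m y := by
      -- The order bounds pair ranks only off the diagonal; for `y = m` the bound follows from the
      -- sign ranks.
      rcases hym.lt_or_eq with hym | rfl
      · exact hpair m y hym
      · have h₂ := rankPair_diag_eq (γ := γ) (τ := τ) (ε := 1) (by decide) m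
        have h₃ := hle 1 (by decide) m
        have h₄ := hle (-1) (by decide) m
        omega
    omega
  · intro x y hxy hax hyk
    have hym := hyk.trans_le hkm
    have hay := hax.trans hxy.le
    -- Slack in both sign ranks at `y` gives a gap of 2 on the diagonal, and the gap at `(x, y)` is
    -- at least as large.
    have h₁ := rankPair_add_le (γ := γ) (τ := τ) (l := y) hxy.le fun s hxs hsy hs => by
      have has := hax.trans_lt hxs
      have hsm := hsy.trans hym.le
      exact hym.trans ((hQ s has hsm).2 (hopen s has hsm (hsy.trans hs.le).not_gt))
    have h₂ := rankPair_diag_eq (γ := γ) (τ := τ) (ε := 1) (by decide) y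
    have h₃ := hsgn 1 y (by decide) hay hym
    have h₄ := hsgn (-1) y (by decide) hay hym
    omega

/-! ### The symbols at the first difference -/

theorem signRank_lt_of_first {γ τ : Clan p q} {f : Fin (p + q)} {δ : SignType}
    (agree : ∀ s < f, γ.mate s = τ.mate s ∧ γ.sign s = τ.sign s)
    (hγ : ¬ (γ.sign f = δ ∨ γ.mate f < f)) (hτ : τ.sign f = δ) :
    γ.signRank δ f < τ.signRank δ f := by
  unfold signRank
  refine Finset.card_lt_card (Finset.ssubset_iff.2 ⟨f, by simp [hγ], ?_⟩)
  intro s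
  simp only [Finset.mem_insert, Finset.mem_filter, Finset.mem_univ, true_and]
  rintro (rfl | ⟨hs, hs'⟩)
  · exact ⟨le_rfl, .inl hτ⟩
  · refine ⟨hs, ?_⟩
    rcases hs.lt_or_eq with hlt | rfl
    · rwa [← (agree s hlt).1, ← (agree s hlt).2]
    · exact absurd hs' hγ

theorem exists_move_of_lt {γ τ : Clan p q} (hlt : γ < τ) :
    ∃ γ', γ < γ' ∧ γ' ≤ τ ∧ Move γ γ' := by
  obtain ⟨h, hne⟩ := hlt
  obtain ⟨hle, hpair⟩ := (le_iff _ _).1 h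
  have hex : ∃ f, ¬ (γ.mate f = τ.mate f ∧ γ.sign f = τ.sign f) := by
    by_contra! hall
    exact hne (Clan.ext (Equiv.ext fun s => (hall s).1) (funext fun s => (hall s).2))
  obtain ⟨f, hf, hfirst⟩ := exists_first hex
  replace hfirst : ∀ s < f, γ.mate s = τ.mate s ∧ γ.sign s = τ.sign s := fun s hs =>
    not_not.1 (hfirst s hs)
  have hmate : γ.mate f = τ.mate f → γ.mate f = f := fun heq => by
    by_contra hfix
    exact hf ⟨heq, by rw [(γ.sign_eq_zero_iff f).2 hfix, (τ.sign_eq_zero_iff f).2 (heq ▸ hfix)]⟩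
  have hγf : f ≤ γ.mate f := by
    by_contra! hlt
    exact hlt.ne (hmate (mate_eq_of_mate_lt (fun s hs => (hfirst s hs).1) hlt).symm)
  have hτf : f ≤ τ.mate f := by
    by_contra! hlt
    have heq := mate_eq_of_mate_lt (fun s hs => (hfirst s hs).1.symm) hlt
    exact hlt.ne (heq ▸ hmate heq)
  rcases hτf.lt_or_eq with hτf | hτf
  · rcases hγf.lt_or_eq with hγf | hγf
    · refine exists_move_of_pair h (fun s hs => (hfirst s hs).1) rfl rfl hγf ?_
      refine lt_of_le_of_ne (not_lt.1 fun hlt => ?_) fun heq => hγf.ne' (hmate heq)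
      -- If `a > m`, the pair of `γ` at `f` is counted in `rankPair f m` and that of `τ` is not,
      -- while earlier pairs agree.
      refine (hpair f _ hτf).not_gt (Finset.card_lt_card (Finset.ssubset_iff.2 ⟨f, by simp, ?_⟩))
      intro s
      simp only [Finset.mem_insert, Finset.mem_filter, Finset.mem_univ, true_and]
      rintro (rfl | ⟨hs, hs'⟩)
      · exact ⟨le_rfl, hlt⟩
      · rcases hs.lt_or_eq with hsf | rfl
        · exact ⟨hs, (hfirst s hsf).1 ▸ hs'⟩
        · exact absurd hs' (lt_irrefl _)
    · exact exists_move_of_sign h (fun s hs => (hfirst s hs).1) (fun s hs => (hfirst s hs).2)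
        ((γ.sign_ne_zero_iff f).2 hγf.symm) rfl rfl hτf
  · have h0 := (τ.sign_ne_zero_iff f).2 hτf.symm
    refine absurd (signRank_lt_of_first hfirst ?_ rfl) (hle _ h0 f).not_gt
    rintro (hs | hlt)
    · have hγ0 := (γ.sign_ne_zero_iff f).1 (hs ▸ h0)
      exact hf ⟨hγ0.trans hτf, hs⟩
    · exact hlt.not_ge hγf

end Clan

theorem mainTheorem3 (p q : ℕ) (γ τ : Clan p q) (hγτ : γ < τ) :
    ∃ γ' : Clan p q, γ < γ' ∧ γ' ≤ τ ∧ Clan.Move γ γ' :=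
  Clan.exists_move_of_lt hγτ
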